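/- Let $\Omega$ be a Polish space, $C_b(\Omega)$ the Banach space of bounded continuous functions $f:\Omega\to\mathbb R$ with the supremum norm, and $\tau_c$ the compact-open topology on $C_b(\Omega)$. Let $M(\Omega)$ be the space of bounded signed Baire measures on $\Omega$ with the total variation norm $\|\mu\|=|\mu|(\Omega)$, and let $\sigma(M(\Omega),C_b(\Omega))$ be the coarsest topology on $M(\Omega)$ for which $\mu\mapsto\int_\Omega f\,d\mu$ is continuous for every $f\in C_b(\Omega)$. For a locally convex topology $\tau$ on a Banach space $X$, a family $(T(t))_{t\ge 0}$ of norm-bounded linear operators on $X$ with $T(0)=I$ and $T(t+s)=T(t)T(s)$ for $s,t\ge 0$ is called a $\tau$-bi-continuous semigroup if (i) $t\mapsto T(t)x$ is $\tau$-continuous on $[0,\infty)$ for every $x\in X$; (ii) $\sup_{t\in[0,1]}\|T(t)\|<\infty$; (iii) for every norm-bounded sequence $(x_n)$ with $x_n\to 0$ in $\tau$ and every $t_0\ge 0$ one has $T(t)x_n\to 0$ in $\tau$ uniformly for $t\in[0,t_0]$. Let $(T(t))_{t\ge 0}$ be a $\tau_c$-bi-continuous semigroup on $C_b(\Omega)$.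 Then: (a) $M(\Omega)$ is a Banach space, and $\tau=\sigma(M(\Omega),C_b(\Omega))$ is an admissible topology on it for the theory of bi-continuous semigroups: $\tau$ is a Hausdorff locally convex topology coarser than the norm topology; every $\tau$-Cauchy sequence in a $\tau$-closed norm-bounded subset of $M(\Omega)$ $\tau$-converges to an element of this subset; and $\|\mu\|=\sup\{|\varphi(\mu)| : \varphi\in (M(\Omega),\tau)',\ \|\varphi\|\le 1\}$ for all $\mu\in M(\Omega)$. (b) Each adjoint $T(t)'$ leaves $M(\Omega)$, regarded as a subspace of $C_b(\Omega)'$ via $\mu\mapsto\left(f\mapsto\int_\Omega f\,d\mu\right)$, invariant, and the restrictions $T(t)^\odot:=T(t)'|_{M(\Omega)}$, that is, $$\int_\Omega f\,d\big(T(t)^\odot\mu\big)=\int_\Omega T(t)f\,d\mu\qquad(t\ge 0,\ \mu\in M(\Omega),\ f\in C_b(\Omega)),$$ form a $\sigma(M(\Omega),C_b(\Omega))$-bi-continuous semigroup on $M(\Omega)$. -/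

import Mathlib

open Filter Topology MeasureTheory
open scoped NNReal BoundedContinuousFunction

/-- `m` is the Baire σ-algebra of the topological space `Ω`: the smallest σ-algebra for which all
continuous real functions are measurable. -/
class IsBaireMeasurableSpace (Ω : Type*) [TopologicalSpace Ω] [m : MeasurableSpace Ω] : Prop where
  measurableSpace_eq : m = ⨆ f : C(Ω, ℝ), MeasurableSpace.comap f (borel ℝ)

/-- The total variation norm `‖μ‖ = |μ|(Ω)` on the space of bounded signed measures. -/
noncomputable instance signedMeasureNormedAddCommGroup (Ω : Type*) [MeasurableSpace Ω] :
    NormedAddCommGroup (SignedMeasure Ω) :=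
  AddGroupNorm.toNormedAddCommGroup
    { toFun := fun μ => μ.totalVariation.real Set.univ
      map_zero' := by simp [SignedMeasure.totalVariation_zero]
      add_le' := fun μ ν => by
        have h : (μ + ν).totalVariation Set.univ
            ≤ (μ.totalVariation + ν.totalVariation) Set.univ := by
          simp only [SignedMeasure.totalVariation_eq_variation]
          exact VectorMeasure.variation_add_le Set.univ
        rw [← measureReal_add_apply]
        exact ENNReal.toReal_mono (measure_ne_top _ _) h
      neg' := fun μ => by simp only [SignedMeasure.totalVariation_neg]
      eq_zero_of_map_eq_zero' := fun μ h => by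
        have h0 : μ.totalVariation Set.univ = 0 :=
          (measureReal_eq_zero_iff (measure_ne_top _ _)).1 h
        rw [SignedMeasure.totalVariation_eq_variation, Measure.measure_univ_eq_zero] at h0
        exact VectorMeasure.variation_eq_zero.1 h0 }

theorem signedMeasure_norm_def {Ω : Type*} [MeasurableSpace Ω] (μ : SignedMeasure Ω) :
    ‖μ‖ = μ.totalVariation.real Set.univ := rfl

noncomputable instance signedMeasureNormedSpace (Ω : Type*) [MeasurableSpace Ω] :
    NormedSpace ℝ (SignedMeasure Ω) where
  norm_smul_le c μ := by
    rw [signedMeasure_norm_def, signedMeasure_norm_def]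
    simp only [SignedMeasure.totalVariation_eq_variation, VectorMeasure.variation_smul]
    simp

/-- The pairing `⟨f, μ⟩ = ∫ f dμ` of a bounded continuous function with a bounded signed measure. -/
noncomputable def measurePairing {Ω : Type*} [TopologicalSpace Ω] [MeasurableSpace Ω]
    (f : Ω →ᵇ ℝ) (μ : SignedMeasure Ω) : ℝ :=
  ∫ᵛ x, f x ∂<•μ

/-- The compact-open topology on `C_b(Ω)`. -/
abbrev compactOpenTopology (Ω : Type*) [TopologicalSpace Ω] : TopologicalSpace (Ω →ᵇ ℝ) :=
  TopologicalSpace.induced BoundedContinuousFunction.toContinuousMap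
    (inferInstance : TopologicalSpace C(Ω, ℝ))

/-- The weak* topology `σ(M(Ω), C_b(Ω))`: the coarsest topology on `M(Ω)` for which all maps
`μ ↦ ∫ f dμ` with `f ∈ C_b(Ω)` are continuous. -/
noncomputable abbrev weakStarTopology (Ω : Type*) [TopologicalSpace Ω] [MeasurableSpace Ω] :
    TopologicalSpace (SignedMeasure Ω) :=
  ⨅ f : Ω →ᵇ ℝ, TopologicalSpace.induced (measurePairing f) (inferInstance : TopologicalSpace ℝ)

/-- The norm dual of `X`. The abbreviation fixes the norm topology on `X`, also where a second
topology on `X` is in scope. -/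
abbrev NormDual (X : Type*) [NormedAddCommGroup X] [NormedSpace ℝ X] : Type _ := X →L[ℝ] ℝ

/-- The standing compatibility conditions between the norm of `X` and the additional topology `τ`
in the theory of bi-continuous semigroups. -/
structure IsBicontinuousSetting {X : Type*} [NormedAddCommGroup X] [NormedSpace ℝ X]
    (τ : TopologicalSpace X) : Prop where
  complete : CompleteSpace X
  isTopologicalAddGroup : @IsTopologicalAddGroup X τ _
  continuousSMul : @ContinuousSMul ℝ X _ _ τ
  locallyConvex : @LocallyConvexSpace ℝ X _ _ _ _ τ
  t2 : @T2Space X τ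
  /-- `τ` is coarser than the norm topology. -/
  coarser : (inferInstance : UniformSpace X).toTopologicalSpace ≤ τ
  /-- Every `τ`-Cauchy sequence in a `τ`-closed, norm-bounded set `C` is `τ`-convergent in `C`. -/
  sequentiallyComplete : ∀ C : Set X, IsClosed[τ] C → Bornology.IsBounded C →
    ∀ x : ℕ → X, (∀ n, x n ∈ C) →
      Tendsto (fun p : ℕ × ℕ => x p.1 - x p.2) atTop (@nhds X τ 0) →
      ∃ y ∈ C, Tendsto x atTop (@nhds X τ y)
  /-- The `τ`-continuous linear functionals are norming. -/
  norming : ∀ x : X, IsLUB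
    {r : ℝ | ∃ φ : NormDual X, Continuous[τ, inferInstance] φ ∧ ‖φ‖ ≤ 1 ∧ r = |φ x|} ‖x‖

/-- `(T(t))_{t ≥ 0}` is a `τ`-bi-continuous semigroup of linear operators on `X`
that are bounded for the norm of `X` (`T` comes before `τ`, so `X →L[ℝ] X` refers to the norm). -/
structure IsBicontinuousSemigroup {X : Type*} [NormedAddCommGroup X] [NormedSpace ℝ X]
    (T : ℝ≥0 → X →L[ℝ] X) (τ : TopologicalSpace X) : Prop where
  map_zero : ∀ x : X, T 0 x = x
  map_add : ∀ (s t : ℝ≥0) (x : X), T (s + t) x = T s (T t x)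
  /-- `τ`-strong continuity. -/
  continuous_orbit : ∀ x : X, Continuous[inferInstance, τ] (fun t : ℝ≥0 => T t x)
  bounded : ∃ M : ℝ, ∀ t : ℝ≥0, t ≤ 1 → ‖T t‖ ≤ M
  /-- Local bi-equicontinuity: for a norm-bounded `τ`-null sequence `x n`, `T t (x n)` tends to `0`
  in `τ`, uniformly for `t` in compact intervals. -/
  locally_biequicontinuous : ∀ x : ℕ → X, (∃ C : ℝ, ∀ n, ‖x n‖ ≤ C) →
    Tendsto x atTop (@nhds X τ 0) →
    ∀ t₀ : ℝ≥0, ∀ U ∈ @nhds X τ 0, ∀ᶠ n in atTop, ∀ t ≤ t₀, T t (x n) ∈ U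

/-! On a Polish space Baire and Borel sets agree, and two facts carry the theorem.

First, `M(Ω)` consists of exactly those functionals on `C_b(Ω)` that are sequentially
`τ_c`-continuous on norm-bounded sets. Measures have this property by dominated convergence.
Conversely (`IsCompactOpenSeqContinuous.exists_measurePairing_eq`), the lattice positive part of
such a functional inherits the continuity, Riesz–Markov–Kakutani represents it by a measure on the
Stone–Čech compactification, and the continuity forces that measure to live on `Ω`, which is a `G_δ`
there. As `T(t)` preserves bounded `τ_c`-null sequences, its adjoint preserves `M(Ω)`.

Second, bounded weak* null sequences `μ n` and bounded `τ_c`-null sequences `g n` have pairings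
tending to `0` (`tendsto_measurePairing_zero`). Otherwise a gliding hump argument glues almost
disjoint pieces of the `g n` into one `G ∈ C_b(Ω)` whose pairings with a subsequence of the `μ n` do
not tend to `0`. This makes weak* limits of bounded Cauchy sequences representable by measures. It
also gives local bi-equicontinuity of the adjoints: if `t n → s`, then `⟨T(t n) f, μ n⟩ = ⟨T(t n) f
- T(s) f, μ n⟩ + ⟨T(s) f, μ n⟩ → 0`.

The Hausdorff and norming properties come from `exists_measurePairing_ge`. -/

theorem IsBaireMeasurableSpace.borelSpace (Ω : Type*) [TopologicalSpace Ω]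
    [TopologicalSpace.MetrizableSpace Ω] [m : MeasurableSpace Ω] [IsBaireMeasurableSpace Ω] :
    BorelSpace Ω := by
  let := TopologicalSpace.metrizableSpaceMetric Ω
  refine ⟨le_antisymm ?_ ?_⟩
  · rw [IsBaireMeasurableSpace.measurableSpace_eq (Ω := Ω)]
    exact iSup_le fun f => f.continuous.borel_measurable.comap_le
  · rw [borel_eq_generateFrom_isClosed]
    refine MeasurableSpace.generateFrom_le fun s hs => ?_
    rcases s.eq_empty_or_nonempty with rfl | hne
    · exact MeasurableSet.empty
    -- A nonempty closed set is the zero set of its distance function, hence a Baire set.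
    let f : C(Ω, ℝ) := ⟨fun x => Metric.infDist x s, Metric.continuous_infDist_pt s⟩
    have hf : s = f ⁻¹' {0} := by
      ext x
      exact hs.mem_iff_infDist_zero hne
    rw [IsBaireMeasurableSpace.measurableSpace_eq (Ω := Ω)]
    exact MeasurableSpace.measurableSet_iSup.2 <|
      MeasurableSpace.measurableSet_generateFrom ⟨f, {0}, isClosed_singleton.measurableSet, hf.symm⟩

theorem tendsto_compactOpenTopology_iff {Ω ι : Type*} [TopologicalSpace Ω] {l : Filter ι}
    {F : ι → Ω →ᵇ ℝ} {f : Ω →ᵇ ℝ} :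
    Tendsto F l (@nhds _ (compactOpenTopology Ω) f) ↔
      ∀ K : Set Ω, IsCompact K → TendstoUniformlyOn (fun i x => F i x) f l K := by
  rw [nhds_induced, tendsto_comap_iff,
    ContinuousMap.tendsto_iff_forall_isCompact_tendstoUniformlyOn]
  rfl

theorem tendsto_compactOpenTopology_zero_iff {Ω ι : Type*} [TopologicalSpace Ω] {l : Filter ι}
    {F : ι → Ω →ᵇ ℝ} :
    Tendsto F l (@nhds _ (compactOpenTopology Ω) 0) ↔
      ∀ K : Set Ω, IsCompact K → ∀ ε > 0, ∀ᶠ i in l, ∀ x ∈ K, |F i x| < ε := by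
  simp [tendsto_compactOpenTopology_iff, Metric.tendstoUniformlyOn_iff, Real.dist_eq]

/-! ### The pairing of measures and bounded continuous functions -/

section Pairing

theorem signedMeasure_norm_eq_variation {Ω : Type*} [MeasurableSpace Ω] (μ : SignedMeasure Ω) :
    ‖μ‖ = μ.variation.real Set.univ := by
  rw [signedMeasure_norm_def, SignedMeasure.totalVariation_eq_variation]

instance isFiniteMeasure_variation_signedMeasure {Ω : Type*} [MeasurableSpace Ω] (μ : SignedMeasure Ω) :
    IsFiniteMeasure μ.variation := by
  rw [← SignedMeasure.totalVariation_eq_variation]; infer_instance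

variable {Ω : Type*} [TopologicalSpace Ω] [MeasurableSpace Ω]

theorem abs_measurePairing_le_integral (f : Ω →ᵇ ℝ) (μ : SignedMeasure Ω) :
    |measurePairing f μ| ≤ ∫ x, |f x| ∂μ.variation := by
  have h : ‖(ContinuousLinearMap.lsmul ℝ ℝ : ℝ →L[ℝ] ℝ →L[ℝ] ℝ).flip‖ ≤ 1 := by
    rw [ContinuousLinearMap.opNorm_flip]
    exact ContinuousLinearMap.opNorm_lsmul_le
  exact VectorMeasure.norm_integral_le_integral_norm.trans
    (mul_le_of_le_one_left (integral_nonneg fun _ => norm_nonneg _) h)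

variable [BorelSpace Ω]

theorem integrable_variation_boundedContinuousFunction (f : Ω →ᵇ ℝ) (μ : SignedMeasure Ω) :
    μ.Integrable f :=
  f.integrable μ.variation

/-- Split the integral at `K`. In the main use `K` is compact and carries most of the mass of `μ`,
so only smallness of `f` on `K` matters. -/
theorem abs_measurePairing_le_of_bounds {f : Ω →ᵇ ℝ} {μ : SignedMeasure Ω} {K : Set Ω}
    (hK : MeasurableSet K) {a b : ℝ} (ha : 0 ≤ a) (haK : ∀ x ∈ K, |f x| ≤ a)
    (hb : ∀ x, |f x| ≤ b) :
    |measurePairing f μ| ≤ a * ‖μ‖ + b * μ.variation.real Kᶜ := by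
  refine (abs_measurePairing_le_integral f μ).trans ?_
  have hi : Integrable (fun x => |f x|) μ.variation := (f.integrable μ.variation).abs
  have hg : Integrable (fun x => a + Kᶜ.indicator (fun _ => b) x) μ.variation :=
    (integrable_const a).add ((integrable_const b).indicator hK.compl)
  calc ∫ x, |f x| ∂μ.variation
      ≤ ∫ x, (a + Kᶜ.indicator (fun _ => b) x) ∂μ.variation := by
        refine integral_mono hi hg fun x => ?_
        by_cases hx : x ∈ K
        · simpa [hx] using haK x hx
        · simpa [hx] using (hb x).trans (le_add_of_nonneg_left ha)
    _ = a * ‖μ‖ + b * μ.variation.real Kᶜ := by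
        rw [integral_add (integrable_const a) ((integrable_const b).indicator hK.compl),
          integral_indicator_const _ hK.compl, integral_const, signedMeasure_norm_eq_variation]
        simp [mul_comm]

theorem abs_measurePairing_le (f : Ω →ᵇ ℝ) (μ : SignedMeasure Ω) :
    |measurePairing f μ| ≤ ‖f‖ * ‖μ‖ := by
  simpa using abs_measurePairing_le_of_bounds (μ := μ) MeasurableSet.univ (norm_nonneg f)
    (fun x _ => f.norm_coe_le_norm x) (fun x => f.norm_coe_le_norm x)

/-- The pairing of `M(Ω)` and `C_b(Ω)` as a continuous bilinear map. -/
noncomputable def measurePairingL (Ω : Type*) [TopologicalSpace Ω] [MeasurableSpace Ω]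
    [BorelSpace Ω] : SignedMeasure Ω →L[ℝ] (Ω →ᵇ ℝ) →L[ℝ] ℝ :=
  LinearMap.mkContinuous₂
    (LinearMap.mk₂ ℝ (fun μ f => measurePairing f μ)
      (fun μ ν f => VectorMeasure.integral_add_vectorMeasure
        (integrable_variation_boundedContinuousFunction f μ)
        (integrable_variation_boundedContinuousFunction f ν))
      (fun c μ f => VectorMeasure.integral_smul_vectorMeasure _ c)
      (fun μ f g => VectorMeasure.integral_fun_add
        (integrable_variation_boundedContinuousFunction f μ)
        (integrable_variation_boundedContinuousFunction g μ))
      (fun c μ f => VectorMeasure.integral_fun_smul μ _ c f)) 1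
    (fun μ f => by
      rw [one_mul, mul_comm]
      exact abs_measurePairing_le f μ)

@[simp] theorem measurePairingL_apply (μ : SignedMeasure Ω) (f : Ω →ᵇ ℝ) :
    measurePairingL Ω μ f = measurePairing f μ := rfl

theorem measurePairing_toSignedMeasure_sub (f : Ω →ᵇ ℝ) (m n : Measure Ω) [IsFiniteMeasure m]
    [IsFiniteMeasure n] :
    measurePairing f (m.toSignedMeasure - n.toSignedMeasure) = ∫ x, f x ∂m - ∫ x, f x ∂n := by
  rw [← measurePairingL_apply, map_sub, sub_apply, measurePairingL_apply,
    measurePairingL_apply, measurePairing, measurePairing, VectorMeasure.integral_toSignedMeasure,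
    VectorMeasure.integral_toSignedMeasure]

theorem measurePairing_eq_posPart_sub_negPart (f : Ω →ᵇ ℝ) (μ : SignedMeasure Ω) :
    measurePairing f μ = ∫ x, f x ∂μ.toJordanDecomposition.posPart
      - ∫ x, f x ∂μ.toJordanDecomposition.negPart := by
  rw [← measurePairing_toSignedMeasure_sub]
  congr 1
  exact μ.toSignedMeasure_toJordanDecomposition.symm

/-- Dominated convergence for the pairing with a fixed measure. -/
theorem tendsto_measurePairing_of_tendsto_compactOpenTopology {ι : Type*} {l : Filter ι}
    [l.IsCountablyGenerated] {F : ι → Ω →ᵇ ℝ} {f : Ω →ᵇ ℝ} {C : ℝ}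
    (hC : ∀ᶠ i in l, ‖F i‖ ≤ C)
    (hF : Tendsto F l (@nhds _ (compactOpenTopology Ω) f)) (μ : SignedMeasure Ω) :
    Tendsto (fun i => measurePairing (F i) μ) l (𝓝 (measurePairing f μ)) := by
  refine VectorMeasure.tendsto_integral_filter_of_norm_le_const
    (Eventually.of_forall fun i => (F i).continuous.aestronglyMeasurable)
    ⟨C, hC.mono fun i hi => ae_of_all _ fun x => ((F i).norm_coe_le_norm x).trans hi⟩
    (ae_of_all _ fun x => ?_)
  exact (tendsto_compactOpenTopology_iff.1 hF {x} isCompact_singleton).tendsto_at rfl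

end Pairing

/-! ### `C_b(Ω)` is norming for `M(Ω)` -/

section Norming

variable {Ω : Type*} [TopologicalSpace Ω] [PolishSpace Ω] [MeasurableSpace Ω] [BorelSpace Ω]

/-- Inner regularity shrinks the two Hahn sets to disjoint closed sets with little loss of mass;
Urysohn gives `f` equal to `1` on one and `-1` on the other. -/
theorem exists_measurePairing_ge (μ : SignedMeasure Ω) {ε : ℝ} (hε : 0 < ε) :
    ∃ f : Ω →ᵇ ℝ, ‖f‖ ≤ 1 ∧ ‖μ‖ - ε ≤ measurePairing f μ := by
  set p := μ.toJordanDecomposition.posPart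
  set n := μ.toJordanDecomposition.negPart
  obtain ⟨S, hS, -, -, hpS, hnS⟩ := μ.toJordanDecomposition.exists_compl_positive_negative
  -- Missed mass is counted twice, since `f` may be off by `2` there; two losses of `2 * (ε / 4)`
  -- add up to `ε`.
  have hε' : ENNReal.ofReal (ε / 4) ≠ 0 := by simp [hε]
  obtain ⟨C, hCS, hC, hCε⟩ := hS.compl.exists_isClosed_sdiff_lt (measure_ne_top p _) hε'
  obtain ⟨D, hDS, hD, hDε⟩ := hS.exists_isClosed_sdiff_lt (measure_ne_top n _) hε'
  have hdisj : Disjoint D C := Set.disjoint_of_subset hDS hCS disjoint_compl_right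
  obtain ⟨f, hfD, hfC, hf⟩ := exists_bounded_mem_Icc_of_closed_of_le hD hC hdisj
    (show (-1 : ℝ) ≤ 1 by norm_num)
  have hfn : ‖f‖ ≤ 1 := (f.norm_le zero_le_one).2 fun x => abs_le.2 (hf x)
  refine ⟨f, hfn, ?_⟩
  have hpC : p.real Cᶜ ≤ ε / 4 := by
    refine ENNReal.toReal_le_of_le_ofReal (by positivity) ?_
    calc p Cᶜ ≤ p (Sᶜ \ C ∪ S) := measure_mono fun x hx => by
            by_cases h : x ∈ S
            · exact Or.inr h
            · exact Or.inl ⟨h, hx⟩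
      _ ≤ p (Sᶜ \ C) + p S := measure_union_le _ _
      _ ≤ _ := by rw [hpS, add_zero]; exact hCε.le
  have hnD : n.real Dᶜ ≤ ε / 4 := by
    refine ENNReal.toReal_le_of_le_ofReal (by positivity) ?_
    calc n Dᶜ ≤ n (S \ D ∪ Sᶜ) := measure_mono fun x hx => by
            by_cases h : x ∈ S
            · exact Or.inl ⟨h, hx⟩
            · exact Or.inr h
      _ ≤ n (S \ D) + n Sᶜ := measure_union_le _ _
      _ ≤ _ := by rw [hnS, add_zero]; exact hDε.le
  have h1 : p.real Set.univ - ε / 2 ≤ ∫ x, f x ∂p := by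
    have : ∫ x, (1 - Cᶜ.indicator (fun _ => (2 : ℝ)) x) ∂p ≤ ∫ x, f x ∂p := by
      refine integral_mono ((integrable_const _).sub
        ((integrable_const _).indicator hC.measurableSet.compl)) (f.integrable p) fun x => ?_
      by_cases hx : x ∈ C
      · simp [hx, hfC hx]
      · simp only [Set.mem_compl_iff, hx, not_false_eq_true, Set.indicator_of_mem]
        linarith [(hf x).1]
    rw [integral_sub (integrable_const _) ((integrable_const _).indicator hC.measurableSet.compl),
      integral_indicator_const _ hC.measurableSet.compl, integral_const] at this
    simp only [smul_eq_mul, mul_one] at this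
    linarith
  have h2 : ∫ x, f x ∂n ≤ -n.real Set.univ + ε / 2 := by
    have : ∫ x, f x ∂n ≤ ∫ x, (-1 + Dᶜ.indicator (fun _ => (2 : ℝ)) x) ∂n := by
      refine integral_mono (f.integrable n) ((integrable_const _).add
        ((integrable_const _).indicator hD.measurableSet.compl)) fun x => ?_
      by_cases hx : x ∈ D
      · simp [hx, hfD hx]
      · simp only [Set.mem_compl_iff, hx, not_false_eq_true, Set.indicator_of_mem]
        linarith [(hf x).2]
    rw [integral_add (integrable_const _) ((integrable_const _).indicator hD.measurableSet.compl),
      integral_indicator_const _ hD.measurableSet.compl, integral_const] at this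
    simp only [smul_eq_mul, mul_neg, mul_one] at this
    linarith
  have h3 : ‖μ‖ = p.real Set.univ + n.real Set.univ := by
    rw [signedMeasure_norm_def, SignedMeasure.totalVariation, measureReal_add_apply]
  rw [measurePairing_eq_posPart_sub_negPart, h3]
  linarith

theorem norm_le_of_forall_measurePairing_le {μ : SignedMeasure Ω} {C : ℝ} (hC : 0 ≤ C)
    (h : ∀ f : Ω →ᵇ ℝ, |measurePairing f μ| ≤ C * ‖f‖) : ‖μ‖ ≤ C := by
  refine le_of_forall_pos_le_add fun ε hε => ?_
  obtain ⟨f, hf, hμ⟩ := exists_measurePairing_ge μ hε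
  have := (le_abs_self _).trans (h f)
  nlinarith

theorem signedMeasure_ext_of_measurePairing {μ ν : SignedMeasure Ω}
    (h : ∀ f : Ω →ᵇ ℝ, measurePairing f μ = measurePairing f ν) : μ = ν := by
  rw [← sub_eq_zero, ← norm_le_zero_iff]
  refine norm_le_of_forall_measurePairing_le le_rfl fun f => ?_
  rw [← measurePairingL_apply, map_sub, sub_apply, measurePairingL_apply,
    measurePairingL_apply, h f]
  simp

end Norming

/-! ### Positive parts of functionals -/

section PosPart

variable {Ω : Type*} [TopologicalSpace Ω]

/-- A functional on `C_b(Ω)` that is sequentially continuous for the compact-open topology on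
norm-bounded sets. -/
def IsCompactOpenSeqContinuous (L : (Ω →ᵇ ℝ) →L[ℝ] ℝ) : Prop :=
  ∀ g : ℕ → Ω →ᵇ ℝ, (∃ C : ℝ, ∀ n, ‖g n‖ ≤ C) →
    Tendsto g atTop (@nhds _ (compactOpenTopology Ω) 0) → Tendsto (fun n => L (g n)) atTop (𝓝 0)

/-- The positive part of a bounded functional on `C_b(Ω)`, evaluated at nonnegative functions. -/
noncomputable def functionalPosPart (L : (Ω →ᵇ ℝ) →L[ℝ] ℝ) (f : Ω →ᵇ ℝ) : ℝ :=
  sSup (L '' Set.Icc 0 f)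

variable {L : (Ω →ᵇ ℝ) →L[ℝ] ℝ} {f g : Ω →ᵇ ℝ}

theorem norm_le_of_mem_Icc (h : g ∈ Set.Icc 0 f) : ‖g‖ ≤ ‖f‖ :=
  (g.norm_le (norm_nonneg f)).2 fun x => by
    have h0 : 0 ≤ g x := h.1 x
    rw [Real.norm_of_nonneg h0]
    exact (h.2 x).trans ((le_abs_self _).trans (f.norm_coe_le_norm x))

theorem le_functionalPosPart (h : g ∈ Set.Icc 0 f) : L g ≤ functionalPosPart L f := by
  refine le_csSup ⟨‖L‖ * ‖f‖, ?_⟩ ⟨g, h, rfl⟩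
  rintro _ ⟨u, hu, rfl⟩
  exact (le_abs_self _).trans ((L.le_opNorm u).trans
    (mul_le_mul_of_nonneg_left (norm_le_of_mem_Icc hu) (norm_nonneg L)))

theorem functionalPosPart_le (hf : 0 ≤ f) {b : ℝ} (h : ∀ g ∈ Set.Icc 0 f, L g ≤ b) :
    functionalPosPart L f ≤ b :=
  csSup_le ⟨L 0, 0, ⟨le_rfl, hf⟩, rfl⟩ (by rintro _ ⟨u, hu, rfl⟩; exact h u hu)

theorem functionalPosPart_nonneg (hf : 0 ≤ f) : 0 ≤ functionalPosPart L f := by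
  simpa using le_functionalPosPart (L := L) (g := 0) ⟨le_rfl, hf⟩

/-- Riesz decomposition: `0 ≤ h ≤ f + g` splits as `h ⊓f` in `[0, f]` plus a remainder in `[0, g]`.
-/
theorem functionalPosPart_add (hf : 0 ≤ f) (hg : 0 ≤ g) :
    functionalPosPart L (f + g) = functionalPosPart L f + functionalPosPart L g := by
  apply le_antisymm
  · refine functionalPosPart_le (add_nonneg hf hg) fun h hh => ?_
    have h1 : h ⊓ f ∈ Set.Icc 0 f := ⟨le_inf hh.1 hf, inf_le_right⟩
    have h2 : h - h ⊓ f ∈ Set.Icc 0 g := by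
      refine ⟨sub_nonneg.2 inf_le_left, fun x => ?_⟩
      have hx : h x ≤ f x + g x := hh.2 x
      have hgx : 0 ≤ g x := hg x
      change h x - min (h x) (f x) ≤ g x
      rcases min_cases (h x) (f x) with h | h <;> linarith
    calc L h = L (h ⊓ f) + L (h - h ⊓ f) := by rw [← map_add]; congr 1; abel
      _ ≤ _ := add_le_add (le_functionalPosPart h1) (le_functionalPosPart h2)
  · rw [← le_sub_iff_add_le]
    refine functionalPosPart_le hf fun u hu => ?_
    rw [le_sub_comm]
    refine functionalPosPart_le hg fun v hv => ?_
    rw [le_sub_iff_add_le', ← map_add]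
    exact le_functionalPosPart ⟨add_nonneg hu.1 hv.1, add_le_add hu.2 hv.2⟩

theorem BoundedContinuousFunction.smul_nonneg_of_nonneg (hf : 0 ≤ f) {c : ℝ} (hc : 0 ≤ c) :
    0 ≤ c • f := fun x => show 0 ≤ c * f x from mul_nonneg hc (hf x)

theorem functionalPosPart_smul (hf : 0 ≤ f) {c : ℝ} (hc : 0 ≤ c) :
    functionalPosPart L (c • f) = c * functionalPosPart L f := by
  have key : ∀ {c : ℝ} {f : Ω →ᵇ ℝ}, 0 ≤ f → 0 < c →
      functionalPosPart L (c • f) ≤ c * functionalPosPart L f := by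
    intro c f hf hc
    refine functionalPosPart_le (BoundedContinuousFunction.smul_nonneg_of_nonneg hf hc.le) fun g hg => ?_
    have h : c⁻¹ • g ∈ Set.Icc 0 f := by
      refine ⟨BoundedContinuousFunction.smul_nonneg_of_nonneg hg.1 (inv_pos.2 hc).le, fun x => ?_⟩
      change c⁻¹ * g x ≤ f x
      rw [inv_mul_le_iff₀ hc]
      exact hg.2 x
    have := le_functionalPosPart (L := L) h
    rw [map_smul, smul_eq_mul, inv_mul_le_iff₀ hc] at this
    exact this
  rcases hc.eq_or_lt with rfl | hc
  · rw [zero_smul, zero_mul]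
    refine le_antisymm (functionalPosPart_le le_rfl fun g hg => ?_)
      (functionalPosPart_nonneg le_rfl)
    rw [le_antisymm hg.2 hg.1, map_zero]
  · refine le_antisymm (key hf hc) ?_
    have := key (f := c • f) (BoundedContinuousFunction.smul_nonneg_of_nonneg hf hc.le) (inv_pos.2 hc)
    rwa [smul_smul, inv_mul_cancel₀ hc.ne', one_smul, le_inv_mul_iff₀ hc] at this

/-- The reflection `g ↦ f - g` maps `[0, f]` to itself and turns `L g` into `L f + (-L) g`. -/
theorem functionalPosPart_sub_neg (hf : 0 ≤ f) :
    functionalPosPart L f - functionalPosPart (-L) f = L f := by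
  have hs : ∀ {g}, g ∈ Set.Icc 0 f → f - g ∈ Set.Icc 0 f := fun hg =>
    ⟨sub_nonneg.2 hg.2, sub_le_self _ hg.1⟩
  apply le_antisymm
  · rw [sub_le_iff_le_add]
    refine functionalPosPart_le hf fun g hg => ?_
    have := le_functionalPosPart (L := -L) (hs hg)
    rw [neg_apply, map_sub] at this
    linarith
  · rw [le_sub_iff_add_le, ← le_sub_iff_add_le']
    refine functionalPosPart_le hf fun g hg => ?_
    have := le_functionalPosPart (L := L) (hs hg)
    rw [map_sub] at this
    rw [neg_apply]
    linarith

theorem IsCompactOpenSeqContinuous.neg (hL : IsCompactOpenSeqContinuous L) :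
    IsCompactOpenSeqContinuous (-L) := fun g hb hg => by
  simpa using (hL g hb hg).neg

/-- Near-maximizers `g n ∈ [0, F n]` are dominated by `F n`, so they form a bounded null sequence
too and `L (g n) → 0`. -/
theorem IsCompactOpenSeqContinuous.tendsto_functionalPosPart (hL : IsCompactOpenSeqContinuous L)
    {F : ℕ → Ω →ᵇ ℝ} (hF : ∀ n, 0 ≤ F n) (hb : ∃ C : ℝ, ∀ n, ‖F n‖ ≤ C)
    (h0 : Tendsto F atTop (@nhds _ (compactOpenTopology Ω) 0)) :
    Tendsto (fun n => functionalPosPart L (F n)) atTop (𝓝 0) := by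
  have hex : ∀ n : ℕ, ∃ g ∈ Set.Icc 0 (F n),
      functionalPosPart L (F n) - 1 / ((n : ℝ) + 1) < L g := by
    intro n
    by_contra! hcon
    have := functionalPosPart_le (hF n) hcon
    have : 0 < 1 / ((n : ℝ) + 1) := by positivity
    linarith
  choose g hg hgL using hex
  have hg0 : Tendsto g atTop (@nhds _ (compactOpenTopology Ω) 0) := by
    rw [tendsto_compactOpenTopology_zero_iff] at h0 ⊢
    intro K hK ε hε
    filter_upwards [h0 K hK ε hε] with n hn x hx
    have h1 : 0 ≤ g n x := (hg n).1 x
    have h2 : g n x ≤ F n x := (hg n).2 x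
    rw [abs_of_nonneg h1]
    exact h2.trans_lt ((le_abs_self _).trans_lt (hn x hx))
  have hgb : ∃ C : ℝ, ∀ n, ‖g n‖ ≤ C :=
    hb.imp fun C hC n => (norm_le_of_mem_Icc (hg n)).trans (hC n)
  have hlim := (hL g hgb hg0).add (tendsto_one_div_add_atTop_nhds_zero_nat (𝕜 := ℝ))
  rw [add_zero] at hlim
  exact squeeze_zero (fun n => functionalPosPart_nonneg (hF n))
    (fun n => by linarith [hgL n]) hlim

end PosPart

/-! ### Positive functionals as measures on the Stone–Čech compactification -/

section StoneCech

variable {Ω : Type*} [TopologicalSpace Ω]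

theorem exists_stoneCech_extension {f : Ω →ᵇ ℝ} (hf : 0 ≤ f) :
    ∃ F : C(StoneCech Ω, ℝ≥0), ∀ x, (F (stoneCechUnit x) : ℝ) = f x := by
  let g : Ω → Set.Icc (0 : ℝ) ‖f‖ := fun x =>
    ⟨f x, hf x, (le_abs_self _).trans (f.norm_coe_le_norm x)⟩
  have hg : Continuous g := f.continuous.subtype_mk _
  let G : StoneCech Ω → Set.Icc (0 : ℝ) ‖f‖ := stoneCechExtend hg
  refine ⟨⟨fun y => ⟨(G y : ℝ), (G y).2.1⟩, ?_⟩, fun x => ?_⟩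
  · exact (continuous_subtype_val.comp (continuous_stoneCechExtend hg)).subtype_mk _
  · change (G (stoneCechUnit x) : ℝ) = f x
    rw [show G (stoneCechUnit x) = g x from stoneCechExtend_stoneCechUnit hg x]

/-- The restriction of a nonnegative continuous function on the Stone–Čech compactification. -/
noncomputable def stoneCechRestrict (F : C(StoneCech Ω, ℝ≥0)) : Ω →ᵇ ℝ :=
  (BoundedContinuousFunction.mkOfCompact
    (⟨fun y => (F y : ℝ), by fun_prop⟩ : C(StoneCech Ω, ℝ))).compContinuous
    ⟨stoneCechUnit, continuous_stoneCechUnit⟩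

@[simp] theorem stoneCechRestrict_apply (F : C(StoneCech Ω, ℝ≥0)) (x : Ω) :
    stoneCechRestrict F x = F (stoneCechUnit x) := rfl

theorem stoneCechRestrict_nonneg (F : C(StoneCech Ω, ℝ≥0)) : 0 ≤ stoneCechRestrict F :=
  fun x => (F (stoneCechUnit x)).2

/-- Riesz–Markov–Kakutani over `ℝ≥0` needs `P` only on the positive cone, where the positive part of
a functional is additive. -/
theorem exists_stoneCech_measure [MeasurableSpace (StoneCech Ω)] [BorelSpace (StoneCech Ω)]
    {P : (Ω →ᵇ ℝ) → ℝ} (h0 : ∀ f, 0 ≤ f → 0 ≤ P f)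
    (hadd : ∀ f g, 0 ≤ f → 0 ≤ g → P (f + g) = P f + P g)
    (hsmul : ∀ (c : ℝ) f, 0 ≤ c → 0 ≤ f → P (c • f) = c * P f) :
    ∃ m : Measure (StoneCech Ω), IsFiniteMeasure m ∧
      ∀ F : C(StoneCech Ω, ℝ≥0), ∫⁻ y, F y ∂m = ENNReal.ofReal (P (stoneCechRestrict F)) := by
  let Λ : CompactlySupportedContinuousMap (StoneCech Ω) ℝ≥0 →ₗ[ℝ≥0] ℝ≥0 :=
    { toFun := fun F => (P (stoneCechRestrict F.toContinuousMap)).toNNReal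
      map_add' := fun F G => by
        rw [← Real.toNNReal_add (h0 _ (stoneCechRestrict_nonneg _))
          (h0 _ (stoneCechRestrict_nonneg _)),
          ← hadd _ _ (stoneCechRestrict_nonneg _) (stoneCechRestrict_nonneg _)]
        congr 2
      map_smul' := fun c F => by
        have h : stoneCechRestrict (c • F).toContinuousMap
            = (c : ℝ) • stoneCechRestrict F.toContinuousMap := rfl
        rw [h, hsmul (c : ℝ) _ c.coe_nonneg (stoneCechRestrict_nonneg _), Real.toNNReal_mul c.coe_nonneg,
          Real.toNNReal_coe, RingHom.id_apply, smul_eq_mul] }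
  have hΛ : ∀ F : C(StoneCech Ω, ℝ≥0), ∫⁻ y, F y ∂(NNRealRMK.rieszMeasure Λ)
      = ENNReal.ofReal (P (stoneCechRestrict F)) := fun F =>
    NNRealRMK.lintegral_rieszMeasure Λ ⟨F, HasCompactSupport.of_compactSpace F⟩
  refine ⟨NNRealRMK.rieszMeasure Λ, ⟨?_⟩, hΛ⟩
  have := hΛ 1
  simp only [ContinuousMap.one_apply, ENNReal.coe_one, lintegral_one] at this
  rw [this]
  exact ENNReal.ofReal_lt_top

end StoneCech

/-! ### Representing functionals by measures on `Ω` -/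

section Riesz

variable {Ω : Type*}

/-- The truncated distance to the first `N + 1` terms of the sequence `d`, scaled by `k + 1`. -/
noncomputable def scaledDist [MetricSpace Ω] (d : ℕ → Ω) (k N : ℕ) : Ω →ᵇ ℝ :=
  BoundedContinuousFunction.ofNormedAddCommGroup
    (fun x => min 1 (((k : ℝ) + 1) * Metric.infDist x (d '' Set.Iic N)))
    (continuous_const.min (continuous_const.mul (Metric.continuous_infDist_pt _))) 1
    (fun x => by
      have h : 0 ≤ ((k : ℝ) + 1) * Metric.infDist x (d '' Set.Iic N) :=
        mul_nonneg (by positivity) Metric.infDist_nonneg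
      rw [Real.norm_of_nonneg (le_min zero_le_one h)]
      exact min_le_left _ _)

section ScaledDist

variable [MetricSpace Ω] {d : ℕ → Ω}

theorem scaledDist_apply (k N : ℕ) (x : Ω) :
    scaledDist d k N x = min 1 (((k : ℝ) + 1) * Metric.infDist x (d '' Set.Iic N)) := rfl

theorem scaledDist_nonneg (k N : ℕ) : 0 ≤ scaledDist d k N := fun _ =>
  le_min zero_le_one (mul_nonneg (by positivity) Metric.infDist_nonneg)

theorem norm_scaledDist_le (k N : ℕ) : ‖scaledDist d k N‖ ≤ 1 :=
  BoundedContinuousFunction.norm_ofNormedAddCommGroup_le _ zero_le_one _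

theorem scaledDist_antitone (k : ℕ) : Antitone fun N => ⇑(scaledDist d k N) := by
  intro M N h x
  refine min_le_min_left _ (mul_le_mul_of_nonneg_left ?_ (by positivity))
  exact Metric.infDist_le_infDist_of_subset (Set.image_mono (Set.Iic_subset_Iic.2 h))
    ⟨d 0, 0, Nat.zero_le _, rfl⟩

theorem tendsto_scaledDist_apply (hd : DenseRange d) (k : ℕ) (x : Ω) :
    Tendsto (fun N => scaledDist d k N x) atTop (𝓝 0) := by
  rw [Metric.tendsto_atTop]
  intro ε hε
  obtain ⟨i, hi⟩ := hd.exists_dist_lt x (show 0 < ε / ((k : ℝ) + 1) by positivity)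
  refine ⟨i, fun N hN => ?_⟩
  have h0 : 0 ≤ scaledDist d k N x := scaledDist_nonneg k N x
  rw [Real.dist_0_eq_abs, abs_of_nonneg h0, scaledDist_apply]
  refine (min_le_right _ _).trans_lt ?_
  have h : Metric.infDist x (d '' Set.Iic N) ≤ dist x (d i) :=
    Metric.infDist_le_dist_of_mem ⟨i, hN, rfl⟩
  rw [lt_div_iff₀' (by positivity)] at hi
  exact (mul_le_mul_of_nonneg_left h (by positivity)).trans_lt hi

/-- Dini's theorem: a decreasing pointwise limit with continuous limit is locally uniform. -/
theorem tendsto_scaledDist (hd : DenseRange d) (k : ℕ) :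
    Tendsto (fun N => scaledDist d k N) atTop (@nhds _ (compactOpenTopology Ω) 0) := by
  have h := (scaledDist_antitone (d := d) k).tendstoLocallyUniformly_of_forall_tendsto
    (fun N => (scaledDist d k N).continuous) (continuous_const (y := (0 : ℝ)))
    (tendsto_scaledDist_apply hd k)
  rw [tendsto_compactOpenTopology_iff]
  intro K hK
  exact (tendstoLocallyUniformlyOn_iff_tendstoUniformlyOn_of_compact hK).1
    h.tendstoLocallyUniformlyOn

theorem exists_dist_lt_of_scaledDist_lt {k N : ℕ} {x : Ω} (h : scaledDist d k N x < 1 / 2) :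
    ∃ i ∈ Set.Iic N, x ∈ Metric.ball (d i) (1 / (2 * ((k : ℝ) + 1))) := by
  rw [scaledDist_apply, min_lt_iff] at h
  have h' : Metric.infDist x (d '' Set.Iic N) < 1 / (2 * ((k : ℝ) + 1)) := by
    rw [lt_div_iff₀ (by positivity)]
    rcases h with h | h
    · norm_num at h
    · linarith
  obtain ⟨_, ⟨i, hi, rfl⟩, hx⟩ := (Metric.infDist_lt_iff (Set.nonempty_Iic.image d)).1 h'
  exact ⟨i, hi, hx⟩

/-- A complete metric space is a `G_δ` in its Stone–Čech compactification. -/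
theorem range_stoneCechUnit_eq [CompleteSpace Ω] (hd : DenseRange d)
    {F : ℕ → ℕ → C(StoneCech Ω, ℝ≥0)}
    (hF : ∀ k N x, (F k N (stoneCechUnit x) : ℝ) = scaledDist d k N x) :
    Set.range (stoneCechUnit : Ω → StoneCech Ω) = ⋂ k, ⋃ N, {y | (F k N y : ℝ) < 1 / 2} := by
  apply Set.Subset.antisymm
  · rintro _ ⟨x, rfl⟩
    refine Set.mem_iInter.2 fun k => Set.mem_iUnion.2 ?_
    obtain ⟨N, hN⟩ := ((tendsto_scaledDist_apply hd k x).eventually_lt_const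
      (show (0 : ℝ) < 1 / 2 by norm_num)).exists
    exact ⟨N, by simpa only [Set.mem_ofPred_eq, hF] using hN⟩
  · intro y hy
    have hne : (comap (stoneCechUnit : Ω → StoneCech Ω) (𝓝 y)).NeBot :=
      isDenseInducing_stoneCechUnit.comap_nhds_neBot y
    -- For each `k` finitely many balls of radius `1 / (2 * (k + 1))` cover a member of `U`, so one
    -- ball belongs to `U`. Thus `U` is Cauchy, and its limit in `Ω` is sent to `y`.
    let U := Ultrafilter.of (comap (stoneCechUnit : Ω → StoneCech Ω) (𝓝 y))
    have hU : Tendsto stoneCechUnit (U : Filter Ω) (𝓝 y) :=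
      tendsto_iff_comap.2 (Ultrafilter.of_le _)
    have hc : Cauchy (U : Filter Ω) := by
      refine Metric.cauchy_iff.2 ⟨U.neBot, fun ε hε => ?_⟩
      obtain ⟨k, hk⟩ := exists_nat_one_div_lt hε
      obtain ⟨N, hN⟩ := Set.mem_iUnion.1 (Set.mem_iInter.1 hy k)
      have ho : IsOpen {y | (F k N y : ℝ) < 1 / 2} :=
        isOpen_lt (NNReal.continuous_coe.comp (F k N).continuous) continuous_const
      have hV : (⋃ i ∈ Set.Iic N, Metric.ball (d i) (1 / (2 * ((k : ℝ) + 1)))) ∈ U := by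
        refine mem_of_superset (hU (ho.mem_nhds hN)) fun x hx => ?_
        have hx' : (F k N (stoneCechUnit x) : ℝ) < 1 / 2 := hx
        rw [hF] at hx'
        simpa only [Set.mem_iUnion, exists_prop] using exists_dist_lt_of_scaledDist_lt hx'
      obtain ⟨i, -, hi⟩ := (Ultrafilter.finite_biUnion_mem_iff (Set.finite_Iic N)).1 hV
      refine ⟨_, hi, fun a ha b hb => ?_⟩
      calc dist a b ≤ dist a (d i) + dist b (d i) := dist_triangle_right _ _ _
        _ < 1 / (2 * ((k : ℝ) + 1)) + 1 / (2 * ((k : ℝ) + 1)) := add_lt_add ha hb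
        _ = 1 / ((k : ℝ) + 1) := by field_simp; norm_num
        _ < ε := hk
    obtain ⟨x, hx⟩ := CompleteSpace.complete hc
    exact ⟨x, tendsto_nhds_unique
      ((continuous_stoneCechUnit.tendsto x).mono_left hx) hU⟩

end ScaledDist

variable [TopologicalSpace Ω] [PolishSpace Ω] [MeasurableSpace Ω] [BorelSpace Ω]

/-- Positive functionals on `C_b(Ω)` that are sequentially continuous for the compact-open topology
on bounded sets are given by finite measures. -/
theorem exists_finiteMeasure_of_positive {P : (Ω →ᵇ ℝ) → ℝ} (h0 : ∀ f, 0 ≤ f → 0 ≤ P f)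
    (hadd : ∀ f g, 0 ≤ f → 0 ≤ g → P (f + g) = P f + P g)
    (hsmul : ∀ (c : ℝ) f, 0 ≤ c → 0 ≤ f → P (c • f) = c * P f)
    (hcont : ∀ F : ℕ → Ω →ᵇ ℝ, (∀ n, 0 ≤ F n) → (∃ C : ℝ, ∀ n, ‖F n‖ ≤ C) →
      Tendsto F atTop (@nhds _ (compactOpenTopology Ω) 0) →
      Tendsto (fun n => P (F n)) atTop (𝓝 0)) :
    ∃ ν : Measure Ω, IsFiniteMeasure ν ∧ ∀ f, 0 ≤ f → P f = ∫ x, f x ∂ν := by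
  rcases isEmpty_or_nonempty Ω with hΩ | hΩ
  · refine ⟨0, inferInstance, fun f hf => ?_⟩
    have hf0 : f = (0 : ℝ) • 0 := by ext x; exact hΩ.elim x
    rw [hf0, hsmul 0 0 le_rfl le_rfl]
    simp
  let := TopologicalSpace.upgradeIsCompletelyMetrizable Ω
  borelize (StoneCech Ω)
  obtain ⟨m, hm, hmP⟩ := exists_stoneCech_measure h0 hadd hsmul
  have hd := TopologicalSpace.denseRange_denseSeq Ω
  choose F hF using fun k N =>
    exists_stoneCech_extension (scaledDist_nonneg (d := TopologicalSpace.denseSeq Ω) k N)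
  have hrange := range_stoneCechUnit_eq hd hF
  have ho : ∀ k N, IsOpen {y | (F k N y : ℝ) < 1 / 2} := fun k N =>
    isOpen_lt (NNReal.continuous_coe.comp (F k N).continuous) continuous_const
  have hmeas : MeasurableSet (Set.range (stoneCechUnit : Ω → StoneCech Ω)) := by
    rw [hrange]
    exact MeasurableSet.iInter fun k => MeasurableSet.iUnion fun N => (ho k N).measurableSet
  -- Where no `F k N` is below `1 / 2`, the indicator is at most `2 * F k N` for every `N`;
  -- integrating bounds the mass by `2 * P (scaledDist _ k N)`, which tends to `0` in `N`.
  have hnull : m (Set.range (stoneCechUnit : Ω → StoneCech Ω))ᶜ = 0 := by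
    rw [hrange, Set.compl_iInter]
    refine measure_iUnion_null fun k => ?_
    have hlim : Tendsto (fun N => 2 * ENNReal.ofReal
        (P (scaledDist (TopologicalSpace.denseSeq Ω) k N))) atTop (𝓝 0) := by
      have := ENNReal.Tendsto.const_mul (a := 2) (ENNReal.tendsto_ofReal (hcont _
        (fun N => scaledDist_nonneg k N) ⟨1, fun N => norm_scaledDist_le k N⟩
        (tendsto_scaledDist hd k))) (Or.inr (by simp))
      simpa using this
    refine le_antisymm (ge_of_tendsto' hlim fun N => ?_) bot_le
    have hr : stoneCechRestrict (F k N) = scaledDist (TopologicalSpace.denseSeq Ω) k N := by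
      ext x; exact hF k N x
    rw [← hr, ← hmP, ← lintegral_const_mul _ (by fun_prop)]
    have hme : MeasurableSet (⋃ N, {y | (F k N y : ℝ) < 1 / 2})ᶜ :=
      (MeasurableSet.iUnion fun N => (ho k N).measurableSet).compl
    rw [← lintegral_indicator_one hme]
    refine lintegral_mono fun y => ?_
    by_cases hy : y ∈ (⋃ N, {y | (F k N y : ℝ) < 1 / 2})ᶜ
    swap
    · rw [Set.indicator_of_notMem hy]
      exact bot_le
    rw [Set.indicator_of_mem hy, Pi.one_apply]
    have hy' : ¬ (F k N y : ℝ) < 1 / 2 := fun h => hy (Set.mem_iUnion.2 ⟨N, h⟩)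
    have : (1 : ℝ≥0) ≤ 2 * F k N y := by
      rw [← NNReal.coe_le_coe]; push_cast; linarith
    simpa using ENNReal.coe_le_coe.2 this
  have hemb : MeasurableEmbedding (stoneCechUnit : Ω → StoneCech Ω) :=
    isEmbedding_stoneCechUnit.measurableEmbedding hmeas
  have hmap : (m.comap stoneCechUnit).map (stoneCechUnit : Ω → StoneCech Ω) = m := by
    rw [hemb.map_comap, Measure.restrict_eq_self_of_ae_mem]
    exact hnull
  refine ⟨m.comap stoneCechUnit, ⟨?_⟩, fun f hf => ?_⟩
  · rw [hemb.comap_apply]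
    exact measure_lt_top _ _
  · obtain ⟨G, hG⟩ := exists_stoneCech_extension hf
    have hr : stoneCechRestrict G = f := by
      ext x; exact hG x
    have hi : ∫⁻ x, ENNReal.ofReal (f x) ∂(m.comap stoneCechUnit) = ENNReal.ofReal (P f) := by
      rw [← hr, ← hmP]
      conv_rhs => rw [← hmap]
      rw [hemb.lintegral_map]
      refine lintegral_congr fun x => ?_
      simp
    have hf' : ∀ x, 0 ≤ f x := fun x => hf x
    rw [integral_eq_lintegral_of_nonneg_ae (ae_of_all _ hf') f.continuous.aestronglyMeasurable, hi,
      ENNReal.toReal_ofReal (h0 f hf)]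

/-- Functionals on `C_b(Ω)` that are sequentially continuous for the compact-open topology on
bounded sets are given by signed measures. -/
theorem IsCompactOpenSeqContinuous.exists_measurePairing_eq {L : (Ω →ᵇ ℝ) →L[ℝ] ℝ}
    (hL : IsCompactOpenSeqContinuous L) :
    ∃ ν : SignedMeasure Ω, ∀ f, measurePairing f ν = L f := by
  have key : ∀ L : (Ω →ᵇ ℝ) →L[ℝ] ℝ, IsCompactOpenSeqContinuous L → ∃ ν : Measure Ω,
      IsFiniteMeasure ν ∧ ∀ f, 0 ≤ f → functionalPosPart L f = ∫ x, f x ∂ν := fun L hL =>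
    exists_finiteMeasure_of_positive (fun _ => functionalPosPart_nonneg)
      (fun _ _ => functionalPosPart_add) (fun _ _ hc hf => functionalPosPart_smul hf hc)
      (fun _ => hL.tendsto_functionalPosPart)
  obtain ⟨m, hm, hmL⟩ := key L hL
  obtain ⟨n, hn, hnL⟩ := key (-L) hL.neg
  have hpos : ∀ f : Ω →ᵇ ℝ, 0 ≤ f →
      measurePairing f (m.toSignedMeasure - n.toSignedMeasure) = L f := fun f hf => by
    rw [measurePairing_toSignedMeasure_sub, ← hmL f hf, ← hnL f hf, functionalPosPart_sub_neg hf]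
  refine ⟨m.toSignedMeasure - n.toSignedMeasure, fun f => ?_⟩
  have hf : f = f ⊔ 0 - (-f) ⊔ 0 := by
    ext x
    change f x = max (f x) 0 - max (-f x) 0
    rcases le_total 0 (f x) with h | h
    · rw [max_eq_left h, max_eq_right (by linarith)]; ring
    · rw [max_eq_right h, max_eq_left (by linarith)]; ring
  rw [hf, map_sub, ← measurePairingL_apply, ContinuousLinearMap.map_sub (measurePairingL Ω _),
    measurePairingL_apply, measurePairingL_apply, hpos _ le_sup_right, hpos _ le_sup_right]

end Riesz

/-! ### The gliding hump argument -/

section GlidingHump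

/-- Soft thresholding: `t ↦ t - clamp(t, -δ, δ)`. -/
noncomputable def softThreshold (δ t : ℝ) : ℝ := t - max (-δ) (min t δ)

theorem continuous_softThreshold (δ : ℝ) : Continuous (softThreshold δ) := by
  unfold softThreshold; fun_prop

theorem abs_softThreshold_sub_le {δ : ℝ} (hδ : 0 ≤ δ) (t : ℝ) : |softThreshold δ t - t| ≤ δ := by
  rw [softThreshold, abs_le]
  rcases max_cases (-δ) (min t δ) with h | h <;> rcases min_cases t δ with h' | h' <;>
    constructor <;> linarith

theorem abs_softThreshold_le {δ : ℝ} (hδ : 0 ≤ δ) (t : ℝ) : |softThreshold δ t| ≤ |t| := by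
  rw [softThreshold]
  rcases max_cases (-δ) (min t δ) with h | h <;> rcases min_cases t δ with h' | h' <;>
    rcases abs_cases t with h'' | h'' <;> rw [abs_le] <;> constructor <;> linarith

theorem softThreshold_eq_zero {δ t : ℝ} (h : |t| ≤ δ) : softThreshold δ t = 0 := by
  rw [abs_le] at h
  rw [softThreshold, min_eq_left h.2, max_eq_right h.1, sub_self]

variable {Ω : Type*} [TopologicalSpace Ω]

/-- A failure yields points converging to `x`; together with `x` they form a compact set on which
`g` is not uniformly small. -/
theorem eventually_prod_abs_lt_of_tendsto_compactOpenTopology [FirstCountableTopology Ω]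
    {g : ℕ → Ω →ᵇ ℝ} (hg : Tendsto g atTop (@nhds _ (compactOpenTopology Ω) 0)) {δ : ℝ}
    (hδ : 0 < δ) (x : Ω) : ∀ᶠ p : ℕ × Ω in atTop ×ˢ 𝓝 x, |g p.1 p.2| < δ := by
  by_contra hcon
  obtain ⟨u, hu, hug⟩ := exists_seq_forall_of_frequently (not_eventually.1 hcon)
  have h1 : Tendsto (fun n => (u n).1) atTop atTop := tendsto_fst.comp hu
  have h2 : Tendsto (fun n => (u n).2) atTop (𝓝 x) := tendsto_snd.comp hu
  have h3 := h1.eventually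
    (tendsto_compactOpenTopology_zero_iff.1 hg _ h2.isCompact_insert_range δ hδ)
  obtain ⟨n, hn⟩ := h3.exists
  exact hug n (hn _ (Or.inr ⟨n, rfl⟩))

theorem locallyFinite_le_abs_of_tendsto_compactOpenTopology [FirstCountableTopology Ω]
    {g : ℕ → Ω →ᵇ ℝ} (hg : Tendsto g atTop (@nhds _ (compactOpenTopology Ω) 0)) {δ : ℝ}
    (hδ : 0 < δ) : LocallyFinite fun n => {x | δ ≤ |g n x|} := by
  intro x
  obtain ⟨p, hp, q, hq, hpq⟩ := eventually_prod_iff.1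
    (eventually_prod_abs_lt_of_tendsto_compactOpenTopology hg hδ x)
  obtain ⟨N, hN⟩ := eventually_atTop.1 hp
  refine ⟨{y | q y}, hq, (Set.finite_Iio N).subset ?_⟩
  rintro n ⟨y, hy, hqy⟩
  by_contra hn
  exact absurd (hpq (hN n (not_lt.1 hn)) hqy) (not_lt.2 hy)

theorem PartitionOfUnity.sum_finset_le_one {ι : Type*} {s : Set Ω} (ρ : PartitionOfUnity ι Ω s)
    (t : Finset ι) (x : Ω) : ∑ i ∈ t, ρ i x ≤ 1 := by
  classical
  refine le_trans ?_ (ρ.sum_le_one x)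
  rw [finsum_eq_sum_of_support_subset (s := t ∪ (ρ.locallyFinite.point_finite x).toFinset)
    (fun i => ρ i x) (fun i hi => by simpa using Or.inr hi)]
  exact Finset.sum_le_sum_of_subset_of_nonneg Finset.subset_union_left
    fun i _ _ => ρ.nonneg i x

/-- Given a null sequence `g n` for the compact-open topology that is small on `K i` for `i < n`,
there are approximations `h n` of `g n` on `K n` whose partial sums are uniformly bounded and that
can be summed along all subsequences. -/
theorem exists_summable_humps [TopologicalSpace.MetrizableSpace Ω] {g : ℕ → Ω →ᵇ ℝ} {C δ : ℝ}
    {K : ℕ → Set Ω} (hgb : ∀ n, ‖g n‖ ≤ C)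
    (hg : Tendsto g atTop (@nhds _ (compactOpenTopology Ω) 0)) (hδ : 0 < δ)
    (hK : ∀ n, IsCompact (K n)) (hKg : ∀ i j, i < j → ∀ x ∈ K i, |g j x| < δ) :
    ∃ h : ℕ → Ω →ᵇ ℝ, (∀ n, ∀ x ∈ K n, |h n x - g n x| ≤ δ) ∧
      (∀ m : ℕ → ℕ, Function.Injective m → ∀ (s : Finset ℕ) x, |∑ i ∈ s, h (m i) x| ≤ C) ∧
      ∀ m : ℕ → ℕ, StrictMono m → ∃ G : Ω →ᵇ ℝ, (∀ x, |G x| ≤ C) ∧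
        ∀ k, ∀ x ∈ K (m k), G x = ∑ i ∈ Finset.range (k + 1), h (m i) x := by
  let := TopologicalSpace.metrizableSpaceMetric Ω
  have hC : 0 ≤ C := (norm_nonneg _).trans (hgb 0)
  have hgx : ∀ n x, |g n x| ≤ C := fun n x => ((g n).norm_coe_le_norm x).trans (hgb n)
  have hlf := locallyFinite_le_abs_of_tendsto_compactOpenTopology hg hδ
  -- The essential parts of the humps: disjoint because `g j` is small on earlier `K i`, and locally
  -- finite. A subordinate partition of unity can thus equal `1` on each of them.
  let A : ℕ → Set Ω := fun n => K n ∩ {x | δ ≤ |g n x|}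
  have hA : ∀ n, IsClosed (A n) := fun n =>
    (hK n).isClosed.inter (isClosed_le continuous_const (g n).continuous.abs)
  have hAlf : LocallyFinite A := hlf.subset fun n => Set.inter_subset_right
  have hAdisj : ∀ i j x, x ∈ A i → x ∈ A j → i = j := by
    intro i j x hi hj
    rcases lt_trichotomy i j with h | h | h
    · exact absurd (hKg i j h x hi.1) (not_lt.2 hj.2)
    · exact h
    · exact absurd (hKg j i h x hj.1) (not_lt.2 hi.2)
  let U : ℕ → Set Ω := fun n => (⋃ j : {j // j ≠ n}, A j)ᶜ
  have hU : ∀ n, IsOpen (U n) := fun n =>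
    ((hAlf.comp_injective Subtype.val_injective).isClosed_iUnion
      fun j => hA j.1).isOpen_compl
  have hAU : ∀ n, A n ⊆ U n := fun n x hx hx' => by
    obtain ⟨j, hj⟩ := Set.mem_iUnion.1 hx'
    exact j.2 (hAdisj _ _ x hj hx)
  obtain ⟨ρ, hρ⟩ := PartitionOfUnity.exists_isSubordinate (hAlf.isClosed_iUnion hA) U hU
    (Set.iUnion_mono hAU)
  have hρA : ∀ n, ∀ x ∈ A n, ρ n x = 1 := by
    intro n x hx
    rw [← ρ.sum_eq_one (Set.mem_iUnion.2 ⟨n, hx⟩)]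
    refine (finsum_eq_single (fun i => ρ i x) n fun i hi => ?_).symm
    by_contra hne
    have hxU : x ∈ U i := hρ i (subset_tsupport _ hne)
    exact hxU (Set.mem_iUnion.2 ⟨⟨n, hi.symm⟩, hx⟩)
  have hbound : ∀ n x, |ρ n x * softThreshold δ (g n x)| ≤ ρ n x * C := fun n x => by
    rw [abs_mul, abs_of_nonneg (ρ.nonneg n x)]
    exact mul_le_mul_of_nonneg_left ((abs_softThreshold_le hδ.le _).trans (hgx n x))
      (ρ.nonneg n x)
  -- Thresholding costs at most `δ` and makes the supports locally finite; the weights `ρ n` bound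
  -- all finite sums by `C`.
  let h : ℕ → Ω →ᵇ ℝ := fun n => BoundedContinuousFunction.ofNormedAddCommGroup
    (fun x => ρ n x * softThreshold δ (g n x))
    ((ρ n).continuous.mul ((continuous_softThreshold δ).comp (g n).continuous)) C
    (fun x => (hbound n x).trans (mul_le_of_le_one_left hC (ρ.le_one n x)))
  have hh : ∀ n x, h n x = ρ n x * softThreshold δ (g n x) := fun _ _ => rfl
  have hsupp : ∀ n, Function.support (h n) ⊆ {x | δ ≤ |g n x|} := fun n x hx => by
    by_contra hlt
    exact hx (by rw [hh, softThreshold_eq_zero (not_le.1 hlt).le, mul_zero])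
  have hsum : ∀ m : ℕ → ℕ, Function.Injective m → ∀ (s : Finset ℕ) x,
      |∑ i ∈ s, h (m i) x| ≤ C := by
    intro m hm s x
    calc |∑ i ∈ s, h (m i) x| ≤ ∑ i ∈ s, |h (m i) x| := Finset.abs_sum_le_sum_abs _ _
      _ ≤ ∑ i ∈ s, ρ (m i) x * C := Finset.sum_le_sum fun i _ => hbound (m i) x
      _ = (∑ i ∈ s.map ⟨m, hm⟩, ρ i x) * C := by rw [Finset.sum_map, Finset.sum_mul]; rfl
      _ ≤ C := mul_le_of_le_one_left hC (ρ.sum_finset_le_one _ x)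
  refine ⟨h, fun n x hx => ?_, hsum, fun m hm => ?_⟩
  · by_cases hxA : δ ≤ |g n x|
    · rw [hh, hρA n x ⟨hx, hxA⟩, one_mul]
      exact abs_softThreshold_sub_le hδ.le _
    · rw [hh, softThreshold_eq_zero (not_le.1 hxA).le, mul_zero, zero_sub, abs_neg]
      exact (not_le.1 hxA).le
  · have hlf' : LocallyFinite fun i => Function.support (h (m i)) :=
      (hlf.comp_injective hm.injective).subset fun i => hsupp (m i)
    have hGb : ∀ x, |∑ᶠ i, h (m i) x| ≤ C := fun x => by
      rw [finsum_eq_sum_of_support_subset (s := (hlf'.point_finite x).toFinset)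
        (fun i => h (m i) x) (fun i hi => by simpa using hi)]
      exact hsum m hm.injective _ x
    refine ⟨BoundedContinuousFunction.ofNormedAddCommGroup (fun x => ∑ᶠ i, h (m i) x)
      (continuous_finsum (fun i => (h (m i)).continuous) hlf') C hGb, hGb, fun k x hx => ?_⟩
    refine finsum_eq_sum_of_support_subset (s := Finset.range (k + 1)) (fun i => h (m i) x)
      fun i hi => ?_
    simp only [Finset.coe_range, Set.mem_Iio]
    by_contra hik
    refine hi ?_
    change h (m i) x = 0
    -- Only terms with index beyond `k` are known to vanish on `K (m k)`, hence the range `k + 1`.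
    rw [hh, softThreshold_eq_zero (hKg (m k) (m i) (hm (by omega)) x hx).le, mul_zero]

variable [PolishSpace Ω] [MeasurableSpace Ω] [BorelSpace Ω]

theorem exists_isCompact_variation_compl_le (μ : SignedMeasure Ω) {δ : ℝ} (hδ : 0 < δ) :
    ∃ K : Set Ω, IsCompact K ∧ μ.variation.real Kᶜ ≤ δ := by
  obtain ⟨K, -, hK, h⟩ := MeasurableSet.univ.exists_isCompact_sdiff_lt
    (measure_ne_top μ.variation _) (ε := ENNReal.ofReal δ) (by simpa using hδ)
  rw [← Set.compl_eq_univ_sdiff] at h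
  exact ⟨K, hK, ENNReal.toReal_le_of_le_ofReal hδ.le h.le⟩

/-- Greedy choice: each new index faces only finitely many eventual conditions. -/
theorem exists_seq_of_eventually {r : ℕ → ℕ → Prop} (h : ∀ i, ∀ᶠ j in atTop, r i j) :
    ∃ m : ℕ → ℕ, StrictMono m ∧ ∀ i j, i < j → r (m i) (m j) := by
  obtain ⟨m, -, hm⟩ := exists_seq_of_forall_finset_exists (fun _ : ℕ => True)
    (fun i j => i < j ∧ r i j) fun s _ => by
      obtain ⟨y, hy⟩ := ((Finset.eventually_all s).2
        fun i _ => (eventually_gt_atTop i).and (h i)).exists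
      exact ⟨y, trivial, hy⟩
  exact ⟨m, fun i j hij => (hm i j hij).1, fun i j hij => (hm i j hij).2⟩

/-- The pairing of a weak* null sequence of measures with a bounded null sequence for the
compact-open topology does not stay away from zero. -/
theorem exists_abs_measurePairing_lt {μ : ℕ → SignedMeasure Ω} {g : ℕ → Ω →ᵇ ℝ} {M C ε : ℝ}
    (hμb : ∀ n, ‖μ n‖ ≤ M)
    (hμ : ∀ f : Ω →ᵇ ℝ, Tendsto (fun n => measurePairing f (μ n)) atTop (𝓝 0))
    (hgb : ∀ n, ‖g n‖ ≤ C) (hg : Tendsto g atTop (@nhds _ (compactOpenTopology Ω) 0))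
    (hε : 0 < ε) : ∃ n, |measurePairing (g n) (μ n)| < ε := by
  by_contra! hcon
  have hM : 0 ≤ M := (norm_nonneg _).trans (hμb 0)
  have hC : 0 ≤ C := (norm_nonneg _).trans (hgb 0)
  -- The errors below add up to at most `δ * M` (thresholding), `4 * C * δ` (two tails off the
  -- compact set) and `2 * δ` (earlier humps), leaving `ε / 2` for the pairing with `G`.
  obtain ⟨δ, hδ, hδε⟩ : ∃ δ > 0, δ * (M + 4 * C + 2) = ε / 2 :=
    ⟨ε / 2 / (M + 4 * C + 2), by positivity, by field_simp⟩
  choose K hK hKμ using fun n => exists_isCompact_variation_compl_le (μ n) hδ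
  obtain ⟨φ, hφ, hφr⟩ := exists_seq_of_eventually fun i =>
    tendsto_compactOpenTopology_zero_iff.1 hg (K i) (hK i) δ hδ
  obtain ⟨h, hhg, hhb, hhG⟩ := exists_summable_humps (g := g ∘ φ) (K := K ∘ φ)
    (fun n => hgb (φ n)) (hg.comp hφ.tendsto_atTop) hδ (fun n => hK (φ n)) hφr
  -- Weak* convergence makes later measures nearly blind to earlier humps, with summable errors.
  obtain ⟨m, hm, hmr⟩ := exists_seq_of_eventually fun i =>
    (((hμ (h i)).comp hφ.tendsto_atTop).abs.eventually_lt_const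
      (show |(0 : ℝ)| < δ * (1 / 2) ^ i by rw [abs_zero]; positivity))
  obtain ⟨G, hGb, hGK⟩ := hhG m hm
  obtain ⟨k, hk⟩ := (((hμ G).comp (hφ.comp hm).tendsto_atTop).abs.eventually_lt_const
    (show |(0 : ℝ)| < ε / 2 by rw [abs_zero]; positivity)).exists
  set ν := μ (φ (m k)) with hν
  have hKm : MeasurableSet (K (φ (m k))) := (hK _).measurableSet
  have hsumk : ∀ x, (∑ i ∈ Finset.range (k + 1), h (m i)) x
      = ∑ i ∈ Finset.range (k + 1), h (m i) x := fun x => by simp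
  have e1 : |measurePairing (G - ∑ i ∈ Finset.range (k + 1), h (m i)) ν|
      ≤ 0 * ‖ν‖ + 2 * C * ν.variation.real (K (φ (m k)))ᶜ := by
    refine abs_measurePairing_le_of_bounds hKm le_rfl (fun x hx => ?_) (fun x => ?_)
    · rw [BoundedContinuousFunction.sub_apply, hsumk, hGK k x hx, sub_self, abs_zero]
    · rw [BoundedContinuousFunction.sub_apply, hsumk]
      have := (abs_sub _ _).trans (add_le_add (hGb x)
        (hhb m hm.injective (Finset.range (k + 1)) x))
      linarith
  have e2 : |measurePairing (h (m k) - g (φ (m k))) ν|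
      ≤ δ * ‖ν‖ + 2 * C * ν.variation.real (K (φ (m k)))ᶜ := by
    refine abs_measurePairing_le_of_bounds hKm hδ.le (fun x hx => hhg (m k) x hx) (fun x => ?_)
    have h1 : |h (m k) x| ≤ C := by simpa using hhb m hm.injective {k} x
    have h2 : |g (φ (m k)) x| ≤ C := ((g _).norm_coe_le_norm x).trans (hgb _)
    have := (abs_sub (h (m k) x) (g (φ (m k)) x)).trans (add_le_add h1 h2)
    rw [BoundedContinuousFunction.sub_apply]
    linarith
  have e3 : |∑ i ∈ Finset.range k, measurePairing (h (m i)) ν| ≤ 2 * δ := by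
    calc |∑ i ∈ Finset.range k, measurePairing (h (m i)) ν|
        ≤ ∑ i ∈ Finset.range k, |measurePairing (h (m i)) ν| := Finset.abs_sum_le_sum_abs _ _
      _ ≤ ∑ i ∈ Finset.range k, δ * (1 / 2) ^ i := Finset.sum_le_sum fun i hi =>
          (hmr i k (Finset.mem_range.1 hi)).le.trans (mul_le_mul_of_nonneg_left
            (pow_le_pow_of_le_one (by norm_num) (by norm_num) hm.le_apply) hδ.le)
      _ ≤ 2 * δ := by
          rw [← Finset.mul_sum, mul_comm]
          exact mul_le_mul_of_nonneg_right (sum_geometric_two_le k) hδ.le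
  have hdecomp : measurePairing (g (φ (m k))) ν = measurePairing G ν
      - measurePairing (G - ∑ i ∈ Finset.range (k + 1), h (m i)) ν
      - measurePairing (h (m k) - g (φ (m k))) ν
      - ∑ i ∈ Finset.range k, measurePairing (h (m i)) ν := by
    simp only [← measurePairingL_apply, map_sub, map_sum, Finset.sum_range_succ, map_add]
    ring
  have hlow : ε ≤ |measurePairing (g (φ (m k))) ν| := hcon (φ (m k))
  have hk' : |measurePairing G ν| < ε / 2 := hk
  have hνM : δ * ‖ν‖ ≤ δ * M := mul_le_mul_of_nonneg_left (hμb _) hδ.le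
  have hνK : 2 * C * ν.variation.real (K (φ (m k)))ᶜ ≤ 2 * C * δ :=
    mul_le_mul_of_nonneg_left (hKμ _) (by positivity)
  rw [hdecomp] at hlow
  have t1 := abs_sub (measurePairing G ν
      - measurePairing (G - ∑ i ∈ Finset.range (k + 1), h (m i)) ν
      - measurePairing (h (m k) - g (φ (m k))) ν)
      (∑ i ∈ Finset.range k, measurePairing (h (m i)) ν)
  have t2 := abs_sub (measurePairing G ν
      - measurePairing (G - ∑ i ∈ Finset.range (k + 1), h (m i)) ν)
      (measurePairing (h (m k) - g (φ (m k))) ν)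
  have t3 := abs_sub (measurePairing G ν)
      (measurePairing (G - ∑ i ∈ Finset.range (k + 1), h (m i)) ν)
  nlinarith

/-- The pairing of a bounded weak* null sequence of measures with a bounded null sequence for the
compact-open topology tends to zero. -/
theorem tendsto_measurePairing_zero {μ : ℕ → SignedMeasure Ω} {g : ℕ → Ω →ᵇ ℝ} {M C : ℝ}
    (hμb : ∀ n, ‖μ n‖ ≤ M)
    (hμ : ∀ f : Ω →ᵇ ℝ, Tendsto (fun n => measurePairing f (μ n)) atTop (𝓝 0))
    (hgb : ∀ n, ‖g n‖ ≤ C) (hg : Tendsto g atTop (@nhds _ (compactOpenTopology Ω) 0)) :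
    Tendsto (fun n => measurePairing (g n) (μ n)) atTop (𝓝 0) := by
  rw [Metric.tendsto_nhds]
  intro ε hε
  by_contra hcon
  obtain ⟨φ, hφ, hφε⟩ := extraction_of_frequently_atTop (not_eventually.1 hcon)
  obtain ⟨n, hn⟩ := exists_abs_measurePairing_lt (fun n => hμb (φ n))
    (fun f => (hμ f).comp hφ.tendsto_atTop) (fun n => hgb (φ n)) (hg.comp hφ.tendsto_atTop) hε
  exact hφε n (by simpa [Real.dist_eq] using hn)

end GlidingHump

/-! ### The weak* topology is admissible -/

section WeakStar

section General

variable {Ω : Type*} [TopologicalSpace Ω] [MeasurableSpace Ω]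

theorem tendsto_weakStarTopology_iff {ι : Type*} {l : Filter ι} {u : ι → SignedMeasure Ω}
    {μ : SignedMeasure Ω} :
    Tendsto u l (@nhds _ (weakStarTopology Ω) μ) ↔
      ∀ f : Ω →ᵇ ℝ, Tendsto (fun i => measurePairing f (u i)) l (𝓝 (measurePairing f μ)) := by
  simp only [nhds_iInf, tendsto_iInf, nhds_induced, tendsto_comap_iff, Function.comp_def]

theorem continuous_weakStarTopology_iff {Y : Type*} [TopologicalSpace Y]
    {u : Y → SignedMeasure Ω} :
    Continuous[inferInstance, weakStarTopology Ω] u ↔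
      ∀ f : Ω →ᵇ ℝ, Continuous fun y => measurePairing f (u y) := by
  simp only [continuous_iInf_rng, continuous_induced_rng, Function.comp_def]

theorem continuous_measurePairing_weakStarTopology (f : Ω →ᵇ ℝ) :
    Continuous[weakStarTopology Ω, inferInstance] (measurePairing (Ω := Ω) f) :=
  continuous_iInf_dom (i := f) continuous_induced_dom

variable [BorelSpace Ω]

/-- The pairing with a fixed bounded continuous function, as an element of the norm dual. -/
noncomputable def measurePairingDual (f : Ω →ᵇ ℝ) : NormDual (SignedMeasure Ω) :=
  (measurePairingL Ω).flip f

@[simp] theorem measurePairingDual_apply (f : Ω →ᵇ ℝ) (μ : SignedMeasure Ω) :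
    measurePairingDual f μ = measurePairing f μ := rfl

theorem tendsto_weakStarTopology_zero_iff {ι : Type*} {l : Filter ι}
    {u : ι → SignedMeasure Ω} :
    Tendsto u l (@nhds _ (weakStarTopology Ω) 0) ↔
      ∀ f : Ω →ᵇ ℝ, Tendsto (fun i => measurePairing f (u i)) l (𝓝 0) := by
  have h : ∀ f : Ω →ᵇ ℝ, measurePairing f 0 = 0 := fun f => map_zero (measurePairingDual f)
  rw [tendsto_weakStarTopology_iff]
  simp only [h]

theorem norm_measurePairingDual_le (f : Ω →ᵇ ℝ) : ‖measurePairingDual f‖ ≤ ‖f‖ :=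
  ContinuousLinearMap.opNorm_le_bound _ (norm_nonneg f) fun μ => abs_measurePairing_le f μ

end General

variable {Ω : Type*} [TopologicalSpace Ω] [PolishSpace Ω] [MeasurableSpace Ω] [BorelSpace Ω]
/-- `M(Ω)` is weak* sequentially complete: bounded weak* Cauchy sequences converge. -/
theorem exists_tendsto_of_cauchySeq_measurePairing {u : ℕ → SignedMeasure Ω} {M : ℝ}
    (hb : ∀ n, ‖u n‖ ≤ M)
    (hu : ∀ f : Ω →ᵇ ℝ, CauchySeq fun n => measurePairing f (u n)) :
    ∃ μ : SignedMeasure Ω, ∀ f : Ω →ᵇ ℝ,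
      Tendsto (fun n => measurePairing f (u n)) atTop (𝓝 (measurePairing f μ)) := by
  choose ℓ hℓ using fun f => cauchySeq_tendsto_of_complete (hu f)
  -- Banach–Steinhaus makes the pointwise limit a bounded functional.
  let L : (Ω →ᵇ ℝ) →L[ℝ] ℝ :=
    continuousLinearMapOfTendsto (fun n => measurePairingL Ω (u n)) (tendsto_pi_nhds.2 hℓ)
  have hL : ∀ f, Tendsto (fun n => measurePairing f (u n)) atTop (𝓝 (L f)) := hℓ
  suffices h : IsCompactOpenSeqContinuous L by
    obtain ⟨μ, hμ⟩ := h.exists_measurePairing_eq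
    exact ⟨μ, fun f => by rw [hμ]; exact hL f⟩
  rintro g ⟨C, hgb⟩ hg
  rw [Metric.tendsto_nhds]
  intro ε hε
  by_contra hcon
  obtain ⟨φ, hφ, hφε⟩ := extraction_of_frequently_atTop (not_eventually.1 hcon)
  have hgφ := hg.comp hφ.tendsto_atTop
  have hj : ∀ k, ∃ j ≥ k, |measurePairing (g (φ j)) (u k)| < ε / 4 := fun k => by
    have h := tendsto_measurePairing_of_tendsto_compactOpenTopology
      (Eventually.of_forall fun n => hgb (φ n)) hgφ (u k)
    rw [show measurePairing 0 (u k) = 0 from map_zero (measurePairingL Ω (u k))] at h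
    obtain ⟨j, hj, hj'⟩ := ((eventually_ge_atTop k).and (h.abs.eventually_lt_const
      (show |(0 : ℝ)| < ε / 4 by rw [abs_zero]; positivity))).exists
    exact ⟨j, hj, hj'⟩
  choose j hjk hj using hj
  -- The differences `u (q k) - u k` are weak* null, yet their pairings with `g (φ (j k))` stay
  -- above `ε - ε / 4 - ε / 4`, against the gliding hump lemma.
  have hq : ∀ k, ∃ q ≥ k, |measurePairing (g (φ (j k))) (u q) - L (g (φ (j k)))| < ε / 4 :=
    fun k => by
      obtain ⟨q, hq, hq'⟩ := ((eventually_ge_atTop k).and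
        (Metric.tendsto_nhds.1 (hL (g (φ (j k)))) (ε / 4) (by positivity))).exists
      exact ⟨q, hq, hq'⟩
  choose q hqk hq using hq
  have hsub : ∀ (f : Ω →ᵇ ℝ) k, measurePairing f (u (q k) - u k)
      = measurePairing f (u (q k)) - measurePairing f (u k) := fun f k =>
    map_sub (measurePairingDual f) _ _
  obtain ⟨k, hk⟩ := exists_abs_measurePairing_lt (μ := fun k => u (q k) - u k)
    (g := fun k => g (φ (j k))) (M := M + M) (C := C) (ε := ε / 2)
    (fun k => (norm_sub_le _ _).trans (add_le_add (hb _) (hb _)))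
    (fun f => by
      simp only [hsub]
      simpa using ((hL f).comp (tendsto_atTop_mono hqk tendsto_id)).sub (hL f))
    (fun k => hgb _) (hgφ.comp (tendsto_atTop_mono hjk tendsto_id)) (by positivity)
  have h1 : ε ≤ |L (g (φ (j k)))| := by simpa [Real.dist_eq] using hφε (j k)
  rw [hsub] at hk
  have h2 := hj k
  have h3 := hq k
  rw [abs_lt] at hk h2 h3
  rcases abs_cases (L (g (φ (j k)))) with h | h <;> linarith

theorem completeSpace_signedMeasure : CompleteSpace (SignedMeasure Ω) := by
  refine Metric.complete_of_cauchySeq_tendsto fun u hu => ?_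
  obtain ⟨M, hM⟩ := hu.norm_bddAbove
  obtain ⟨μ, hμ⟩ := exists_tendsto_of_cauchySeq_measurePairing (fun n => hM ⟨n, rfl⟩)
    (fun f => (measurePairingDual f).uniformContinuous.comp_cauchySeq hu)
  refine ⟨μ, Metric.tendsto_atTop.2 fun ε hε => ?_⟩
  obtain ⟨N, hN⟩ := Metric.cauchySeq_iff.1 hu (ε / 2) (by positivity)
  refine ⟨N, fun n hn => lt_of_le_of_lt ?_ (half_lt_self hε)⟩
  rw [dist_eq_norm]
  -- Weak* lower semicontinuity of the norm: the Cauchy estimate passes to the limit in each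
  -- pairing.
  refine norm_le_of_forall_measurePairing_le (by positivity) fun f => ?_
  have hlim : Tendsto (fun m => |measurePairing f (u n) - measurePairing f (u m)|) atTop
      (𝓝 |measurePairing f (u n) - measurePairing f μ|) := ((hμ f).const_sub _).abs
  have hsub : ∀ ν, measurePairing f (u n - ν) = measurePairing f (u n) - measurePairing f ν :=
    fun ν => map_sub (measurePairingDual f) _ _
  rw [hsub]
  refine le_of_tendsto hlim ((eventually_ge_atTop N).mono fun m hm => ?_)
  rw [← hsub]
  refine (abs_measurePairing_le f _).trans ?_
  rw [mul_comm, ← dist_eq_norm]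
  exact mul_le_mul_of_nonneg_right (hN n hn m hm).le (norm_nonneg f)

variable (Ω) in
/-- The weak* topology is an admissible topology on `M(Ω)`. -/
theorem isBicontinuousSetting_weakStarTopology :
    IsBicontinuousSetting (weakStarTopology Ω) where
  complete := completeSpace_signedMeasure
  isTopologicalAddGroup :=
    topologicalAddGroup_iInf fun f => topologicalAddGroup_induced (measurePairingDual f)
  continuousSMul :=
    continuousSMul_iInf fun f => continuousSMul_induced (measurePairingDual f)
  locallyConvex :=
    LocallyConvexSpace.iInf fun f => LocallyConvexSpace.induced (measurePairingDual f).toLinearMap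
  t2 := by
    refine @T2Space.mk _ (weakStarTopology Ω) fun μ ν hne => ?_
    obtain ⟨f, hf⟩ : ∃ f : Ω →ᵇ ℝ, measurePairing f μ ≠ measurePairing f ν := by
      by_contra! h
      exact hne (signedMeasure_ext_of_measurePairing h)
    obtain ⟨U, V, hU, hV, hμ, hν, hUV⟩ := t2_separation hf
    have hc := continuous_measurePairing_weakStarTopology (Ω := Ω) f
    exact ⟨_, _, @IsOpen.preimage _ _ (weakStarTopology Ω) _ _ hc _ hU,
      @IsOpen.preimage _ _ (weakStarTopology Ω) _ _ hc _ hV, hμ, hν, hUV.preimage _⟩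
  coarser := le_iInf fun f => continuous_iff_le_induced.1 (measurePairingDual f).continuous
  sequentiallyComplete := by
    intro C hC hCb u huC hu
    obtain ⟨M, hM⟩ := isBounded_iff_forall_norm_le.1 hCb
    obtain ⟨μ, hμ⟩ := exists_tendsto_of_cauchySeq_measurePairing (fun n => hM _ (huC n))
      fun f => by
        rw [cauchySeq_iff_tendsto_dist_atTop_0]
        have := (tendsto_weakStarTopology_zero_iff.1 hu f).abs
        simpa only [Real.dist_eq, abs_zero, ← measurePairingDual_apply, map_sub] using this
    have hlim := tendsto_weakStarTopology_iff.2 hμ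
    exact ⟨μ, @IsClosed.mem_of_tendsto _ (weakStarTopology Ω) _ _ _ _ _ _ hC hlim
      (Eventually.of_forall huC), hlim⟩
  norming := by
    refine fun μ => ⟨?_, fun b hb => le_of_forall_pos_le_add fun ε hε => ?_⟩
    · rintro _ ⟨φ, -, hφ, rfl⟩
      exact (φ.le_opNorm μ).trans (mul_le_of_le_one_left (norm_nonneg μ) hφ)
    · obtain ⟨f, hf, hμ⟩ := exists_measurePairing_ge μ hε
      have h := hb ⟨measurePairingDual f, continuous_measurePairing_weakStarTopology f,
        (norm_measurePairingDual_le f).trans hf, rfl⟩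
      rw [measurePairingDual_apply] at h
      linarith [le_abs_self (measurePairing f μ)]

end WeakStar

/-! ### The adjoint semigroup -/

section Adjoint

variable {Ω : Type*} [TopologicalSpace Ω]

theorem Filter.Tendsto.sub_const_compactOpenTopology {ι : Type*} {l : Filter ι}
    {F : ι → Ω →ᵇ ℝ} {f : Ω →ᵇ ℝ} (h : Tendsto F l (@nhds _ (compactOpenTopology Ω) f)) :
    Tendsto (fun i => F i - f) l (@nhds _ (compactOpenTopology Ω) 0) := by
  rw [tendsto_compactOpenTopology_zero_iff]
  intro K hK ε hε
  filter_upwards [Metric.tendstoUniformlyOn_iff.1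
    (tendsto_compactOpenTopology_iff.1 h K hK) ε hε] with i hi x hx
  rw [BoundedContinuousFunction.sub_apply, ← Real.dist_eq, dist_comm]
  exact hi x hx

theorem exists_norm_le_of_semigroup {X : Type*} [NormedAddCommGroup X] [NormedSpace ℝ X]
    {T : ℝ≥0 → X →L[ℝ] X} (h0 : ∀ x, T 0 x = x) (hadd : ∀ s t x, T (s + t) x = T s (T t x))
    (hb : ∃ M : ℝ, ∀ t ≤ 1, ‖T t‖ ≤ M) (t₀ : ℝ≥0) : ∃ C : ℝ, ∀ t ≤ t₀, ‖T t‖ ≤ C := by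
  obtain ⟨M, hM⟩ := hb
  have h1 : (1 : ℝ) ≤ max M 1 := le_max_right _ _
  have key : ∀ (n : ℕ) (t : ℝ≥0), t ≤ n → ‖T t‖ ≤ max M 1 ^ n := by
    intro n
    induction n with
    | zero =>
      intro t ht
      obtain rfl : t = 0 := le_antisymm (by simpa using ht) bot_le
      refine ContinuousLinearMap.opNorm_le_bound _ (by positivity) fun x => ?_
      simp [h0]
    | succ n ih =>
      intro t ht
      rcases le_total t 1 with h | h
      · exact ((hM t h).trans (le_max_left _ _)).trans (le_self_pow₀ h1 (Nat.succ_ne_zero n))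
      · have hts : t - 1 ≤ n := by
          rw [tsub_le_iff_right]; exact_mod_cast ht
        have hTt : T t = (T 1).comp (T (t - 1)) := by
          ext x
          rw [ContinuousLinearMap.comp_apply, ← hadd, add_tsub_cancel_of_le h]
        rw [hTt, pow_succ']
        exact (ContinuousLinearMap.opNorm_comp_le _ _).trans (mul_le_mul
          ((hM 1 le_rfl).trans (le_max_left _ _)) (ih _ hts) (norm_nonneg _) (by positivity))
  obtain ⟨n, hn⟩ := exists_nat_ge t₀
  exact ⟨_, fun t ht => key n t (ht.trans hn)⟩

variable [PolishSpace Ω] [MeasurableSpace Ω] [BorelSpace Ω]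

/-- An operator on `C_b(Ω)` that is sequentially continuous for the compact-open topology on
bounded sets has an adjoint on `M(Ω)`. -/
theorem exists_adjoint_signedMeasure {A : (Ω →ᵇ ℝ) →L[ℝ] (Ω →ᵇ ℝ)}
    (hA : ∀ g : ℕ → Ω →ᵇ ℝ, (∃ C : ℝ, ∀ n, ‖g n‖ ≤ C) →
      Tendsto g atTop (@nhds _ (compactOpenTopology Ω) 0) →
      Tendsto (fun n => A (g n)) atTop (@nhds _ (compactOpenTopology Ω) 0)) :
    ∃ S : SignedMeasure Ω →L[ℝ] SignedMeasure Ω, ‖S‖ ≤ ‖A‖ ∧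
      ∀ μ f, measurePairing f (S μ) = measurePairing (A f) μ := by
  have hex : ∀ μ : SignedMeasure Ω, ∃ ν : SignedMeasure Ω,
      ∀ f, measurePairing f ν = measurePairing (A f) μ := by
    intro μ
    have hL : IsCompactOpenSeqContinuous ((measurePairingL Ω μ).comp A) := by
      rintro g ⟨C, hC⟩ hg
      have h := tendsto_measurePairing_of_tendsto_compactOpenTopology (C := ‖A‖ * C)
        (Eventually.of_forall fun n => (A.le_opNorm (g n)).trans
          (mul_le_mul_of_nonneg_left (hC n) (norm_nonneg A))) (hA g ⟨C, hC⟩ hg) μ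
      rwa [show measurePairing 0 μ = 0 from map_zero (measurePairingL Ω μ)] at h
    exact hL.exists_measurePairing_eq
  choose S hS using hex
  refine ⟨LinearMap.mkContinuous ⟨⟨S, fun μ ν => ?_⟩, fun c μ => ?_⟩ ‖A‖ fun μ => ?_,
    LinearMap.mkContinuous_norm_le _ (norm_nonneg A) _, hS⟩
  · refine signedMeasure_ext_of_measurePairing fun f => ?_
    rw [hS, ← measurePairingDual_apply, ← measurePairingDual_apply, map_add, map_add]
    simp only [measurePairingDual_apply, hS]
  · refine signedMeasure_ext_of_measurePairing fun f => ?_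
    rw [hS, ← measurePairingDual_apply, ← measurePairingDual_apply, map_smul, map_smul]
    simp only [measurePairingDual_apply, hS, RingHom.id_apply]
  · refine norm_le_of_forall_measurePairing_le (by positivity) fun f => ?_
    change |measurePairing f (S μ)| ≤ _
    rw [hS]
    calc |measurePairing (A f) μ| ≤ ‖A f‖ * ‖μ‖ := abs_measurePairing_le _ _
      _ ≤ ‖A‖ * ‖f‖ * ‖μ‖ := mul_le_mul_of_nonneg_right (A.le_opNorm f) (norm_nonneg μ)
      _ = ‖A‖ * ‖μ‖ * ‖f‖ := by ring

/-- The adjoints on `M(Ω)` of a bi-continuous semigroup on `C_b(Ω)` form a bi-continuous semigroup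
for the weak* topology. -/
theorem IsBicontinuousSemigroup.adjoint {T : ℝ≥0 → (Ω →ᵇ ℝ) →L[ℝ] (Ω →ᵇ ℝ)}
    (hT : IsBicontinuousSemigroup T (compactOpenTopology Ω))
    {S : ℝ≥0 → SignedMeasure Ω →L[ℝ] SignedMeasure Ω} (hST : ∀ t, ‖S t‖ ≤ ‖T t‖)
    (hS : ∀ t μ f, measurePairing f (S t μ) = measurePairing (T t f) μ) :
    IsBicontinuousSemigroup S (weakStarTopology Ω) where
  map_zero μ := signedMeasure_ext_of_measurePairing fun f => by rw [hS, hT.map_zero]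
  map_add s t μ := signedMeasure_ext_of_measurePairing fun f => by
    -- Adjoints reverse the order of composition; commutativity of addition restores it.
    rw [hS, hS, hS, add_comm, hT.map_add]
  continuous_orbit μ := by
    refine continuous_weakStarTopology_iff.2 fun f => continuous_iff_continuousAt.2 fun t => ?_
    simp only [hS]
    obtain ⟨C, hC⟩ := exists_norm_le_of_semigroup hT.map_zero hT.map_add hT.bounded (t + 1)
    refine tendsto_measurePairing_of_tendsto_compactOpenTopology (C := C * ‖f‖) ?_
      (@Continuous.tendsto _ _ _ (compactOpenTopology Ω) _ (hT.continuous_orbit f) t) μ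
    filter_upwards [Iic_mem_nhds (lt_add_one t)] with s hs
    exact ((T s).le_opNorm f).trans (mul_le_mul_of_nonneg_right (hC s hs) (norm_nonneg f))
  bounded := hT.bounded.imp fun M hM t ht => (hST t).trans (hM t ht)
  locally_biequicontinuous := by
    rintro u ⟨M, hM⟩ hu t₀ U hU
    rw [tendsto_weakStarTopology_zero_iff] at hu
    by_contra hcon
    obtain ⟨φ, hφ, hφU⟩ := extraction_of_frequently_atTop (not_eventually.1 hcon)
    push Not at hφU
    choose t ht htU using hφU
    -- Compactness of `[0, t₀]` replaces uniformity in `t` by convergence along one sequence of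
    -- times.
    obtain ⟨s, -, ψ, hψ, hs⟩ := (isCompact_Icc (a := (0 : ℝ≥0)) (b := t₀)).tendsto_subseq
      fun n => ⟨bot_le, ht n⟩
    have hφψ := (hφ.comp hψ).tendsto_atTop
    have hlim : Tendsto (fun n => S (t (ψ n)) (u (φ (ψ n)))) atTop
        (@nhds _ (weakStarTopology Ω) 0) := by
      refine tendsto_weakStarTopology_zero_iff.2 fun f => ?_
      obtain ⟨C, hC⟩ := exists_norm_le_of_semigroup hT.map_zero hT.map_add hT.bounded t₀
      have hg : Tendsto (fun n => T (t (ψ n)) f - T s f) atTop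
          (@nhds _ (compactOpenTopology Ω) 0) :=
        Filter.Tendsto.sub_const_compactOpenTopology
          ((@Continuous.tendsto _ _ _ (compactOpenTopology Ω) _ (hT.continuous_orbit f) s).comp hs)
      have h1 := tendsto_measurePairing_zero (μ := fun n => u (φ (ψ n))) (M := M)
        (C := C * ‖f‖ + ‖T s f‖) (fun n => hM _) (fun f => (hu f).comp hφψ)
        (fun n => (norm_sub_le _ _).trans (add_le_add_left (((T _).le_opNorm f).trans
          (mul_le_mul_of_nonneg_right (hC _ (ht _)) (norm_nonneg f))) _)) hg
      have h2 := h1.add ((hu (T s f)).comp hφψ)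
      rw [add_zero] at h2
      refine h2.congr fun n => ?_
      rw [hS, ← measurePairingL_apply, map_sub]
      simp
    obtain ⟨n, hn⟩ := (hlim.eventually hU).exists
    exact htU _ hn

end Adjoint

theorem theorem3p5 (Ω : Type*) [TopologicalSpace Ω] [PolishSpace Ω]
    [MeasurableSpace Ω] [IsBaireMeasurableSpace Ω]
    (T : ℝ≥0 → (Ω →ᵇ ℝ) →L[ℝ] (Ω →ᵇ ℝ))
    (hT : IsBicontinuousSemigroup T (compactOpenTopology Ω)) :
    IsBicontinuousSetting (weakStarTopology Ω) ∧
    ∃ S : ℝ≥0 → SignedMeasure Ω →L[ℝ] SignedMeasure Ω,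
      (∀ (t : ℝ≥0) (μ : SignedMeasure Ω) (f : Ω →ᵇ ℝ),
        measurePairing f (S t μ) = measurePairing (T t f) μ) ∧
      IsBicontinuousSemigroup S (weakStarTopology Ω) := by
  have := IsBaireMeasurableSpace.borelSpace Ω
  refine ⟨isBicontinuousSetting_weakStarTopology Ω, ?_⟩
  -- Local bi-equicontinuity at the single time `t` is the sequential continuity needed for the
  -- adjoint.
  choose S hST hS using fun t => exists_adjoint_signedMeasure (A := T t) fun g hb hg U hU =>
    (hT.locally_biequicontinuous g hb hg t U hU).mono fun n hn => hn t le_rfl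
  exact ⟨S, hS, hT.adjoint hST hS⟩
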